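/- Let $(M,g)$ be a compact connected smooth Riemannian manifold (without boundary) of dimension $m\ge 0$. For complex-valued functions $\phi,\psi$ of class $C^2$ on $M$ (in particular for smooth ones), let $\tau(\phi)=\operatorname{div}(\nabla\phi)$ be the Laplace–Beltrami operator and $\kappa(\phi,\psi)=g(\nabla\phi,\nabla\psi)$, where $g$ is extended complex bilinearly to the complexified tangent bundle; in local coordinates $$\tau(\phi)=\sum_{i,j=1}^m\frac{1}{\sqrt{|g|}}\frac{\partial}{\partial x_j}\Big(g^{ij}\sqrt{|g|}\,\frac{\partial\phi}{\partial x_i}\Big),\qquad \kappa(\phi,\psi)=\sum_{i,j=1}^m g^{ij}\,\frac{\partial\phi}{\partial x_i}\frac{\partial\psi}{\partial x_j},$$ where $(g^{ij})$ is the inverse of the matrix $(g_{ij})$ of $g$ and $|g|=\det(g_{ij})$. For $\lambda,\mu\in\mathbb{C}$, a set $\mathcal F$ of such functions is called a $(\lambda,\mu)$-eigenfamily if $\tau(\phi)=\lambda\,\phi$ and $\kappa(\phi,\psi)=\mu\,\phi\,\psi$ on $M$ for all $\phi,\psi\in\mathcal F$. Let $\lambda\in\mathbb{C}$ and let $\mathcal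 F$ be a $(\lambda,\lambda)$-eigenfamily on $M$. Then $\dim_{\mathbb C}\big(\operatorname{span}_{\mathbb C}(\mathcal F)\big)\le 1$. -/

import Mathlib

open scoped Manifold ContDiff Bundle

noncomputable section

namespace Eigenfamily

/-- The model space `ℝⁿ`. -/
abbrev Model (n : ℕ) : Type := EuclideanSpace ℝ (Fin n)

/-- A smooth Riemannian metric on the tangent bundle of a smooth `n`-manifold `M`. -/
abbrev Metric (n : ℕ) (M : Type*) [TopologicalSpace M] [ChartedSpace (Model n) M]
    [IsManifold (𝓡 n) ∞ M] :=
  Bundle.ContMDiffRiemannianMetric (𝓡 n) ∞ (Model n) (fun x : M ↦ TangentSpace (𝓡 n) x)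

/-- The partial derivative `∂f/∂x_i` at `y` of a complex-valued function on `ℝⁿ`. -/
def partialDeriv {n : ℕ} (i : Fin n) (f : Model n → ℂ) (y : Model n) : ℂ :=
  fderiv ℝ f y (EuclideanSpace.single i 1)

variable {n : ℕ} {M : Type*} [TopologicalSpace M] [ChartedSpace (Model n) M]

/-- The coordinate vector field `∂/∂x_i` of the chart `e`, at the point with coordinates `y`. -/
def coordVector (e : OpenPartialHomeomorph M (Model n)) (i : Fin n) (y : Model n) :
    TangentSpace (𝓡 n) (e.symm y) :=
  mfderiv (𝓡 n) (𝓡 n) e.symm y (EuclideanSpace.single i (1 : ℝ) : Model n)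

variable [IsManifold (𝓡 n) ∞ M]

/-- The matrix `(g_ij)` of the metric in the chart `e`, as a function of the coordinates. -/
def metricMatrix (g : Metric n M) (e : OpenPartialHomeomorph M (Model n)) (y : Model n) :
    Matrix (Fin n) (Fin n) ℝ :=
  Matrix.of fun i j ↦ g.inner (e.symm y) (coordVector e i y) (coordVector e j y)

/-- The Riemannian density `√|g|`, `|g| = det (g_ij)`, in the chart `e`. -/
def density (g : Metric n M) (e : OpenPartialHomeomorph M (Model n)) (y : Model n) : ℝ :=
  √(metricMatrix g e y).det

/-- The Laplace-Beltrami operator in the local coordinates given by the chart `e`: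
`τ(φ) = ∑ i j, (1/√|g|) ∂/∂x_j (g^ij √|g| ∂φ/∂x_i)` at the point `p` of the domain of `e`. -/
def tau (g : Metric n M) (e : OpenPartialHomeomorph M (Model n)) (φ : M → ℂ) (p : M) : ℂ :=
  ∑ i, ∑ j, ((1 / density g e (e p) : ℝ) : ℂ) *
    partialDeriv j (fun y ↦ (((metricMatrix g e y)⁻¹ i j * density g e y : ℝ) : ℂ) *
      partialDeriv i (φ ∘ e.symm) y) (e p)

/-- The conformality operator `κ(φ,ψ) = g(∇φ,∇ψ)` (with `g` extended complex bilinearly) in the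
local coordinates given by the chart `e`: `κ(φ,ψ) = ∑ i j, g^ij ∂φ/∂x_i ∂ψ/∂x_j`
at the point `p` of the domain of `e`. -/
def kappa (g : Metric n M) (e : OpenPartialHomeomorph M (Model n)) (φ ψ : M → ℂ) (p : M) : ℂ :=
  ∑ i, ∑ j, (((metricMatrix g e (e p))⁻¹ i j : ℝ) : ℂ) *
    partialDeriv i (φ ∘ e.symm) (e p) * partialDeriv j (ψ ∘ e.symm) (e p)

/-- A set `F` of complex-valued functions on `M` is a `(lam, mu)`-eigenfamily if
`τ(φ) = lam φ` and `κ(φ,ψ) = mu φ ψ` on `M` for all `φ, ψ ∈ F`, where `τ` and `κ` are computed in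
the charts of the atlas of `M`. The functions are of class `C²`, which is what `τ` requires;
this includes the smooth ones. -/
structure IsEigenfamily (g : Metric n M) (lam mu : ℂ) (F : Set (M → ℂ)) : Prop where
  contMDiff : ∀ φ ∈ F, ContMDiff (𝓡 n) 𝓘(ℝ, ℂ) 2 φ
  tau_eq : ∀ φ ∈ F, ∀ e ∈ atlas (Model n) M, ∀ p ∈ e.source, tau g e φ p = lam * φ p
  kappa_eq : ∀ φ ∈ F, ∀ ψ ∈ F, ∀ e ∈ atlas (Model n) M, ∀ p ∈ e.source,
    kappa g e φ ψ p = mu * (φ p * ψ p)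

end Eigenfamily

end

/-!
If `χ` belongs to a `(lam, mu)`-eigenfamily, then
`τ(|χ|²) = 2 Re(lam) |χ|² + 2 κ(χ, conj χ) ≥ 2 (Re(lam) + |mu|) |χ|²`, because
`κ(χ, conj χ) ≥ |κ(χ, χ)|` by positivity of the metric. When `Re(lam) + |mu| ≥ 0`, in particular
when `mu = lam`, the function `|χ|²` is therefore subharmonic, and E. Hopf's strong maximum
principle makes it constant. The span of an eigenfamily is again an eigenfamily, so an element of
the span that vanishes at one point vanishes identically: evaluation at a point embeds the span
into `ℂ`.
-/

namespace Eigenfamily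

section LinearAlgebra

theorem sum_sum_transpose_mul_self_smul {R V W ι κ : Type*} [CommSemiring R] [AddCommMonoid V]
    [Module R V] [AddCommMonoid W] [Module R W] [Fintype ι] [Fintype κ] (C : Matrix κ ι R)
    (β : V →ₗ[R] V →ₗ[R] W) (v : ι → V) :
    ∑ i, ∑ j, (C.transpose * C) i j • β (v i) (v j) =
      ∑ k, β (∑ i, C k i • v i) (∑ j, C k j • v j) := by
  simp only [map_sum, map_smul, LinearMap.sum_apply, LinearMap.smul_apply, Matrix.mul_apply,
    Matrix.transpose_apply, Finset.sum_smul, Finset.smul_sum, smul_smul]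
  rw [Finset.sum_comm_cycle]
  exact Finset.sum_congr rfl fun k _ ↦ Finset.sum_comm.trans <|
    Finset.sum_congr rfl fun i _ ↦ Finset.sum_congr rfl fun j _ ↦ by rw [mul_comm]

variable {ι : Type*} [Fintype ι] {B : Matrix ι ι ℝ}

open scoped MatrixOrder in
theorem exists_eq_transpose_mul_self_of_posSemidef (hB : B.PosSemidef) :
    ∃ C : Matrix ι ι ℝ, B = C.transpose * C := by
  classical exact CStarAlgebra.nonneg_iff_eq_star_mul_self.mp hB.nonneg

theorem norm_sum_sum_mul_le_sum_sum_inner (hB : B.PosSemidef) (v : ι → ℂ) :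
    ‖∑ i, ∑ j, (B i j : ℂ) * v i * v j‖ ≤ ∑ i, ∑ j, B i j * inner ℝ (v i) (v j) := by
  obtain ⟨C, rfl⟩ := exists_eq_transpose_mul_self_of_posSemidef hB
  have hmul := sum_sum_transpose_mul_self_smul C (LinearMap.mul ℝ ℂ) v
  have hinner := sum_sum_transpose_mul_self_smul C (innerₗ ℂ) v
  simp only [LinearMap.mul_apply', Complex.real_smul, ← mul_assoc] at hmul
  simp only [innerₗ_apply_apply, real_inner_self_eq_norm_sq, smul_eq_mul,
    Complex.real_smul] at hinner
  rw [hmul, hinner]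
  refine (norm_sum_le _ _).trans_eq (Finset.sum_congr rfl fun k _ ↦ ?_)
  rw [norm_mul, sq]

theorem sum_sum_mul_pos_of_posDef (hB : B.PosDef) {v : ι → ℝ} (hv : v ≠ 0) :
    0 < ∑ i, ∑ j, B i j * (v i * v j) := by
  refine (hB.dotProduct_mulVec_pos hv).trans_eq ?_
  simp only [dotProduct, Matrix.mulVec, Finset.mul_sum, star_trivial, mul_left_comm]

end LinearAlgebra

section SecondDerivative

variable {E F : Type*} [NormedAddCommGroup E] [NormedSpace ℝ E] [NormedAddCommGroup F]
  [NormedSpace ℝ F]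

theorem differentiableAt_fderiv_of_contDiffAt_two {u : E → F} {x : E} (hu : ContDiffAt ℝ 2 u x) :
    DifferentiableAt ℝ (fderiv ℝ u) x :=
  (hu.fderiv_right (m := 1) (by norm_num)).differentiableAt (by norm_num)

theorem eventually_differentiableAt_of_contDiffAt_two {u : E → F} {x : E}
    (hu : ContDiffAt ℝ 2 u x) : ∀ᶠ y in nhds x, DifferentiableAt ℝ u y :=
  (hu.eventually (by simp)).mono fun _ h ↦ h.differentiableAt (by norm_num)

theorem fderiv_fderiv_add {u v : E → F} {x : E} (hu : ContDiffAt ℝ 2 u x)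
    (hv : ContDiffAt ℝ 2 v x) :
    fderiv ℝ (fderiv ℝ (u + v)) x = fderiv ℝ (fderiv ℝ u) x + fderiv ℝ (fderiv ℝ v) x := by
  have h : fderiv ℝ (u + v) =ᶠ[nhds x] fderiv ℝ u + fderiv ℝ v := by
    filter_upwards [eventually_differentiableAt_of_contDiffAt_two hu,
      eventually_differentiableAt_of_contDiffAt_two hv] with y hy hy' using fderiv_add hy hy'
  rw [h.fderiv_eq, fderiv_add (differentiableAt_fderiv_of_contDiffAt_two hu)
    (differentiableAt_fderiv_of_contDiffAt_two hv)]

theorem fderiv_smul_fderiv_apply {a : E → ℝ} {u : E → F} {x : E} (ha : DifferentiableAt ℝ a x)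
    (hu : ContDiffAt ℝ 2 u x) (v w : E) :
    fderiv ℝ (fun y ↦ a y • fderiv ℝ u y v) x w =
      a x • fderiv ℝ (fderiv ℝ u) x v w + fderiv ℝ a x w • fderiv ℝ u x v := by
  have hsymm : IsSymmSndFDerivAt ℝ u x := hu.isSymmSndFDerivAt (by simp)
  have hdu := (differentiableAt_fderiv_of_contDiffAt_two hu).hasFDerivAt.clm_apply
    (hasFDerivAt_const v x)
  rw [(ha.hasFDerivAt.fun_smul hdu).fderiv, hsymm.eq]
  simp

theorem fderiv_norm_sq_apply {H : Type*} [NormedAddCommGroup H] [InnerProductSpace ℝ H]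
    {u : E → H} {x : E} (hu : DifferentiableAt ℝ u x) (a : E) :
    fderiv ℝ (fun y ↦ ‖u y‖ ^ 2) x a = 2 * inner ℝ (u x) (fderiv ℝ u x a) := by
  simp [hu.hasFDerivAt.norm_sq.fderiv]

theorem fderiv_fderiv_norm_sq_apply {H : Type*} [NormedAddCommGroup H] [InnerProductSpace ℝ H]
    {u : E → H} {x : E} (hu : ContDiffAt ℝ 2 u x) (a b : E) :
    fderiv ℝ (fderiv ℝ (fun y ↦ ‖u y‖ ^ 2)) x a b =
      2 * (inner ℝ (u x) (fderiv ℝ (fderiv ℝ u) x a b) +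
        inner ℝ (fderiv ℝ u x a) (fderiv ℝ u x b)) := by
  have hsq := differentiableAt_fderiv_of_contDiffAt_two (hu.norm_sq ℝ)
  have hdu := (differentiableAt_fderiv_of_contDiffAt_two hu).hasFDerivAt.clm_apply
    (hasFDerivAt_const b x)
  have heq : (fun y ↦ fderiv ℝ (fun y ↦ ‖u y‖ ^ 2) y b) =ᶠ[nhds x]
      fun y ↦ 2 * inner ℝ (u y) (fderiv ℝ u y b) :=
    (eventually_differentiableAt_of_contDiffAt_two hu).mono fun y hy ↦ fderiv_norm_sq_apply hy b
  have hleft := (hsq.hasFDerivAt.clm_apply (hasFDerivAt_const b x)).fderiv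
  have hright := (((hu.differentiableAt (by norm_num)).hasFDerivAt.inner ℝ hdu).const_mul 2).fderiv
  have := DFunLike.congr_fun (hleft.symm.trans (heq.fderiv_eq.trans hright)) a
  simpa [fderivInnerCLM_apply] using this

theorem deriv_deriv_nonpos_of_isLocalMax {f : ℝ → ℝ} {t : ℝ} (hf : ContinuousAt f t)
    (hmax : IsLocalMax f t) : deriv (deriv f) t ≤ 0 := by
  by_contra! hpos
  have hmin := isLocalMin_of_deriv_deriv_pos hpos hmax.deriv_eq_zero hf
  have hconst : f =ᶠ[nhds t] fun _ ↦ f t := by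
    filter_upwards [hmax, hmin] with s h h' using le_antisymm h h'
  simp [hconst.deriv.deriv_eq] at hpos

theorem deriv_deriv_comp_add_smul {u : E → F} {x : E} (hu : ContDiffAt ℝ 2 u x) (a : E) :
    deriv (deriv fun t : ℝ ↦ u (x + t • a)) 0 = fderiv ℝ (fderiv ℝ u) x a a := by
  have hline : ∀ t : ℝ, HasDerivAt (fun t : ℝ ↦ x + t • a) a t := fun t ↦ by
    simpa only [one_smul, id] using ((hasDerivAt_id t).smul_const a).const_add x
  have hlim : Filter.Tendsto (fun t : ℝ ↦ x + t • a) (nhds 0) (nhds x) := by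
    simpa using (hline 0).continuousAt.tendsto
  have hderiv : (deriv fun t : ℝ ↦ u (x + t • a)) =ᶠ[nhds 0] fun t ↦ fderiv ℝ u (x + t • a) a := by
    filter_upwards [hlim.eventually (eventually_differentiableAt_of_contDiffAt_two hu)] with t ht
    exact (ht.hasFDerivAt.comp_hasDerivAt t (hline t)).deriv
  have hsnd : HasDerivAt (fun t : ℝ ↦ fderiv ℝ u (x + t • a)) (fderiv ℝ (fderiv ℝ u) x a) 0 :=
    (differentiableAt_fderiv_of_contDiffAt_two hu).hasFDerivAt.comp_hasDerivAt_of_eq 0 (hline 0)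
      (by simp)
  rw [hderiv.deriv_eq, (hsnd.clm_apply (hasDerivAt_const (0 : ℝ) a)).deriv, map_zero, add_zero]

theorem fderiv_fderiv_apply_self_nonpos_of_isLocalMax {u : E → ℝ} {x : E}
    (hu : ContDiffAt ℝ 2 u x) (hmax : IsLocalMax u x) (a : E) :
    fderiv ℝ (fderiv ℝ u) x a a ≤ 0 := by
  have hline : ContinuousAt (fun t : ℝ ↦ x + t • a) 0 := by fun_prop
  have hx : x + (0 : ℝ) • a = x := by simp
  rw [← deriv_deriv_comp_add_smul hu]
  refine deriv_deriv_nonpos_of_isLocalMax (hu.continuousAt.comp_of_eq hline hx) ?_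
  exact IsMaxFilter.comp_tendsto (by rwa [hx]) (by simpa only [ContinuousAt, hx] using hline)

end SecondDerivative

section EllipticOperator

variable {ι F : Type*} [Fintype ι] [DecidableEq ι] [NormedAddCommGroup F] [NormedSpace ℝ F]
  {A : EuclideanSpace ℝ ι → Matrix ι ι ℝ} {b : EuclideanSpace ℝ ι → EuclideanSpace ℝ ι}
  {x : EuclideanSpace ℝ ι}

/-- The second-order differential operator `u ↦ ∑ i j, A_ij ∂_i ∂_j u + ∑ i, b_i ∂_i u` without
zeroth-order term, in non-divergence form. -/
noncomputable def ellipticOp (A : EuclideanSpace ℝ ι → Matrix ι ι ℝ)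
    (b : EuclideanSpace ℝ ι → EuclideanSpace ℝ ι) (u : EuclideanSpace ℝ ι → F)
    (x : EuclideanSpace ℝ ι) : F :=
  ∑ i, ∑ j, A x i j • fderiv ℝ (fderiv ℝ u) x (EuclideanSpace.single i 1)
    (EuclideanSpace.single j 1) + fderiv ℝ u x (b x)

theorem ellipticOp_add {u v : EuclideanSpace ℝ ι → F} (hu : ContDiffAt ℝ 2 u x)
    (hv : ContDiffAt ℝ 2 v x) :
    ellipticOp A b (u + v) x = ellipticOp A b u x + ellipticOp A b v x := by
  simp only [ellipticOp, fderiv_fderiv_add hu hv, fderiv_add (hu.differentiableAt two_ne_zero)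
    (hv.differentiableAt two_ne_zero), add_apply, smul_add, Finset.sum_add_distrib]
  abel

theorem ellipticOp_const_smul {𝕜 : Type*} [Field 𝕜] [Module 𝕜 F] [SMulCommClass ℝ 𝕜 F]
    [ContinuousConstSMul 𝕜 F] (c : 𝕜) (u : EuclideanSpace ℝ ι → F) :
    ellipticOp A b (c • u) x = c • ellipticOp A b u x := by
  have hfderiv : fderiv ℝ (c • u) = c • fderiv ℝ u := fderiv_const_smul_field c
  have hsnd : fderiv ℝ (c • fderiv ℝ u) = c • fderiv ℝ (fderiv ℝ u) :=
    fderiv_const_smul_field (F := EuclideanSpace ℝ ι →L[ℝ] F) c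
  simp only [ellipticOp, hfderiv, hsnd, FunLike.coe_smul, Pi.smul_apply, smul_add,
    Finset.smul_sum, smul_comm (_ : ℝ) c]

theorem ellipticOp_norm_sq {H : Type*} [NormedAddCommGroup H] [InnerProductSpace ℝ H]
    {u : EuclideanSpace ℝ ι → H} (hu : ContDiffAt ℝ 2 u x) :
    ellipticOp A b (fun y ↦ ‖u y‖ ^ 2) x = 2 * (inner ℝ (u x) (ellipticOp A b u x) +
      ∑ i, ∑ j, A x i j * inner ℝ (fderiv ℝ u x (EuclideanSpace.single i 1))
        (fderiv ℝ u x (EuclideanSpace.single j 1))) := by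
  simp only [ellipticOp, fderiv_fderiv_norm_sq_apply hu,
    fderiv_norm_sq_apply (hu.differentiableAt two_ne_zero), inner_add_right, inner_sum,
    real_inner_smul_right, smul_eq_mul, mul_add, mul_left_comm _ (2 : ℝ), ← Finset.mul_sum,
    Finset.sum_add_distrib]
  abel

theorem continuousAt_ellipticOp {u : EuclideanSpace ℝ ι → F} (hA : ContinuousAt A x)
    (hb : ContinuousAt b x) (hu : ContDiffAt ℝ 2 u x) : ContinuousAt (ellipticOp A b u) x := by
  have hdu : ContDiffAt ℝ 1 (fderiv ℝ u) x := hu.fderiv_right (by norm_num)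
  have hddu : ContinuousAt (fderiv ℝ (fderiv ℝ u)) x :=
    (hdu.fderiv_right (m := 0) (by norm_num)).continuousAt
  have hAij : ∀ i j, ContinuousAt (fun y ↦ A y i j) x := fun i j ↦
    continuousAt_pi.1 (continuousAt_pi.1 hA i) j
  refine ContinuousAt.add (tendsto_finsetSum _ fun i _ ↦ tendsto_finsetSum _ fun j _ ↦ ?_)
    (hdu.continuousAt.clm_apply hb)
  exact (hAij i j).smul ((hddu.clm_apply continuousAt_const).clm_apply continuousAt_const)

theorem ellipticOp_nonpos_of_isLocalMax {u : EuclideanSpace ℝ ι → ℝ} (hA : (A x).PosSemidef)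
    (hu : ContDiffAt ℝ 2 u x) (hmax : IsLocalMax u x) : ellipticOp A b u x ≤ 0 := by
  obtain ⟨C, hC⟩ := exists_eq_transpose_mul_self_of_posSemidef hA
  have hsum := sum_sum_transpose_mul_self_smul C
    ((ContinuousLinearMap.coeLM ℝ).comp (fderiv ℝ (fderiv ℝ u) x).toLinearMap)
    fun i ↦ EuclideanSpace.single i 1
  rw [ellipticOp, hmax.fderiv_eq_zero, zero_apply, add_zero, hC]
  exact hsum.trans_le (Finset.sum_nonpos fun k _ ↦
    fderiv_fderiv_apply_self_nonpos_of_isLocalMax hu hmax _)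

theorem exists_mem_frontier_ge_of_ellipticOp_pos {K : Set (EuclideanSpace ℝ ι)}
    {u : EuclideanSpace ℝ ι → ℝ} (hK : IsCompact K) (hA : ∀ y ∈ interior K, (A y).PosSemidef)
    (huK : ContinuousOn u K) (hu : ∀ y ∈ interior K, ContDiffAt ℝ 2 u y)
    (hL : ∀ y ∈ interior K, 0 < ellipticOp A b u y) (hx : x ∈ K) :
    ∃ y ∈ frontier K, u x ≤ u y := by
  obtain ⟨y, hyK, hy⟩ := hK.exists_isMaxOn ⟨x, hx⟩ huK
  refine ⟨y, ⟨subset_closure hyK, fun hyi ↦ ?_⟩, hy hx⟩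
  exact (hL y hyi).not_ge (ellipticOp_nonpos_of_isLocalMax (hA y hyi) (hu y hyi)
    (hy.isLocalMax (mem_interior_iff_mem_nhds.1 hyi)))

end EllipticOperator

section StrongMaximumPrinciple

theorem exists_pos_forall_add_mul_neg {X : Type*} [TopologicalSpace X] [T2Space X] {K : Set X}
    {f v : X → ℝ} (hK : IsCompact K) (hf : ContinuousOn f K) (hv : ContinuousOn v K)
    (hf0 : ∀ x ∈ K, f x ≤ 0) (hfv : ∀ x ∈ K, f x = 0 → v x < 0) :
    ∃ ε > 0, ∀ x ∈ K, f x + ε * v x < 0 := by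
  let K' := K ∩ v ⁻¹' Set.Ici 0
  have hK' : IsCompact K' :=
    hK.of_isClosed_subset (hv.preimage_isClosed_of_isClosed hK.isClosed isClosed_Ici)
      Set.inter_subset_left
  have hfneg : ∀ x ∈ K', f x < 0 := fun x hx ↦
    (hf0 x hx.1).lt_of_ne fun h ↦ (hfv x hx.1 h).not_ge hx.2
  obtain ⟨C, hC⟩ := hK'.bddAbove_image (f := fun x ↦ v x / -f x)
    ((hv.mono Set.inter_subset_left).div (hf.mono Set.inter_subset_left).neg
      fun x hx ↦ (neg_pos.2 (hfneg x hx)).ne')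
  refine ⟨1 / (|C| + 1), by positivity, fun x hx ↦ ?_⟩
  rcases lt_or_ge (v x) 0 with hvx | hvx
  · exact add_neg_of_nonpos_of_neg (hf0 x hx) (mul_neg_of_pos_of_neg (by positivity) hvx)
  · have hfx := hfneg x ⟨hx, hvx⟩
    have hvf : v x ≤ |C| * -f x :=
      ((div_le_iff₀ (neg_pos.2 hfx)).1 (hC (Set.mem_image_of_mem _ ⟨hx, hvx⟩))).trans
        (mul_le_mul_of_nonneg_right (le_abs_self C) (neg_nonneg.2 hfx.le))
    have hquot : v x / (|C| + 1) < -f x := (div_lt_iff₀ (by positivity)).2 (by linarith)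
    rw [one_div_mul_eq_div]
    linarith

theorem dist_lt_of_dist_midpoint_le {E : Type*} [NormedAddCommGroup E] [NormedSpace ℝ E]
    [StrictConvexSpace ℝ E] {x y z : E} (h : dist x (midpoint ℝ y z) ≤ dist y (midpoint ℝ y z))
    (hne : x ≠ y) : dist x z < dist y z := by
  have hx : (1 / 2 : ℝ) • (x - z) =
      (1 / 2 : ℝ) • (x - midpoint ℝ y z) + (1 / 2 : ℝ) • (y - midpoint ℝ y z) := by
    rw [midpoint_eq_smul_add, invOf_eq_inv]
    module
  have hy : (1 / 2 : ℝ) • (y - z) = y - midpoint ℝ y z := by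
    rw [midpoint_eq_smul_add, invOf_eq_inv]
    module
  rw [dist_eq_norm, dist_eq_norm] at h ⊢
  have hlt := norm_combo_lt_of_ne h le_rfl (sub_left_injective.ne hne) one_half_pos one_half_pos
    (add_halves 1)
  rw [← hx, ← hy, norm_smul, norm_smul] at hlt
  exact lt_of_mul_lt_mul_left hlt (norm_nonneg _)

variable {ι : Type*} [Fintype ι] [DecidableEq ι] {A : EuclideanSpace ℝ ι → Matrix ι ι ℝ}
  {b : EuclideanSpace ℝ ι → EuclideanSpace ℝ ι} {u : EuclideanSpace ℝ ι → ℝ}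
  {x y z : EuclideanSpace ℝ ι} {Ω : Set (EuclideanSpace ℝ ι)}

theorem exists_ellipticOp_add_mul_sq_pos (hA : (A y).PosDef) (hu : ContDiffAt ℝ 2 u y)
    (huy : u y = 0) (hdu : fderiv ℝ u y ≠ 0) :
    ∃ N : ℝ, 0 < ellipticOp A b (u + N • fun x ↦ ‖u x‖ ^ 2) y := by
  let q := ∑ i, ∑ j, A y i j * (fderiv ℝ u y (EuclideanSpace.single i 1) *
    fderiv ℝ u y (EuclideanSpace.single j 1))
  have hq : 0 < q := by
    refine sum_sum_mul_pos_of_posDef hA fun h ↦ hdu ?_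
    refine ContinuousLinearMap.coe_injective ((EuclideanSpace.basisFun ι ℝ).toBasis.ext fun i ↦ ?_)
    simpa using congrFun h i
  have hsq : ellipticOp A b (fun x ↦ ‖u x‖ ^ 2) y = 2 * q := by
    simp only [ellipticOp_norm_sq hu, huy, q, RCLike.inner_apply', conj_trivial, zero_mul,
      zero_add]
  let N := (1 - ellipticOp A b u y) / (2 * q)
  have hN : ContDiffAt ℝ 2 (N • fun x ↦ ‖u x‖ ^ 2) y := (hu.norm_sq ℝ).const_smul N
  refine ⟨N, ?_⟩
  rw [ellipticOp_add hu hN, ellipticOp_const_smul, hsq, smul_eq_mul,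
    div_mul_cancel₀ _ (by positivity)]
  linarith

theorem exists_barrier (hA : ContinuousAt A y) (hb : ContinuousAt b y) (hAy : (A y).PosDef)
    (hyz : y ≠ z) :
    ∃ v : EuclideanSpace ℝ ι → ℝ, ContDiff ℝ 2 v ∧ v y = 0 ∧
      (∀ᶠ x in nhds y, 0 < ellipticOp A b v x) ∧ ∀ᶠ x in nhds y, dist y z < dist x z → v x < 0 := by
  let s : EuclideanSpace ℝ ι → ℝ := fun x ↦ ‖y - z‖ ^ 2 - ‖x - z‖ ^ 2
  have hs : ContDiff ℝ 2 s := contDiff_const.sub ((contDiff_id.sub contDiff_const).norm_sq ℝ)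
  have hsy : s y = 0 := sub_self _
  have hds : fderiv ℝ s y (y - z) ≠ 0 := by
    rw [fderiv_const_sub, neg_apply, fderiv_norm_sq_apply (by fun_prop), fderiv_sub_const,
      fderiv_fun_id, ContinuousLinearMap.id_apply, real_inner_self_eq_norm_sq]
    simpa using sub_ne_zero.2 hyz
  -- Near `y` the function `s + N s² = s (1 + N s)` has the sign of `s`, while the operator applied
  -- to `s²` is positive at `y`.
  obtain ⟨N, hN⟩ := exists_ellipticOp_add_mul_sq_pos (b := b) hAy hs.contDiffAt hsy
    fun h ↦ hds (by rw [h, zero_apply])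
  have hv : ContDiff ℝ 2 (s + N • fun x ↦ ‖s x‖ ^ 2) := hs.add ((hs.norm_sq ℝ).const_smul N)
  refine ⟨s + N • fun x ↦ ‖s x‖ ^ 2, hv, by simp [hsy],
    (continuousAt_ellipticOp hA hb hv.contDiffAt).eventually (lt_mem_nhds hN), ?_⟩
  have hfactor : ∀ᶠ x in nhds y, 0 < 1 + N * s x := by
    refine (continuousAt_const.add (continuousAt_const.mul hs.continuous.continuousAt)).eventually
      (lt_mem_nhds ?_)
    simp [hsy]
  filter_upwards [hfactor] with x hx hxz
  have hsx : s x < 0 := by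
    rw [dist_eq_norm, dist_eq_norm] at hxz
    exact sub_neg.2 (pow_lt_pow_left₀ hxz (norm_nonneg _) two_ne_zero)
  calc (s + N • fun x ↦ ‖s x‖ ^ 2) x = s x * (1 + N * s x) := by
        simp only [Pi.add_apply, Pi.smul_apply, Real.norm_eq_abs, sq_abs, smul_eq_mul]
        ring
    _ < 0 := mul_neg_of_neg_of_pos hsx hx

theorem exists_lt_of_ellipticOp_nonneg_of_touching_ball (hΩ : IsOpen Ω)
    (hA : ContinuousOn A Ω) (hb : ContinuousOn b Ω) (hpos : ∀ x ∈ Ω, (A x).PosDef)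
    (hu : ContDiffOn ℝ 2 u Ω) (hL : ∀ x ∈ Ω, 0 ≤ ellipticOp A b u x) (hy : y ∈ Ω) (hyz : y ≠ z)
    (hball : ∀ x ∈ Ω, dist x z ≤ dist y z → x ≠ y → u x < u y) :
    ∃ x ∈ Ω, u y < u x := by
  by_contra! hmax
  have hΩy : Ω ∈ nhds y := hΩ.mem_nhds hy
  obtain ⟨v, hv, hvy, hLv, hvneg⟩ :=
    exists_barrier (hA.continuousAt hΩy) (hb.continuousAt hΩy) (hpos y hy) hyz
  obtain ⟨r, hr, hrs⟩ := Metric.nhds_basis_closedBall.eventually_iff.1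
    ((hΩ.eventually_mem hy).and (hLv.and hvneg))
  have hrΩ : Metric.closedBall y r ⊆ Ω := fun x hx ↦ (hrs hx).1
  have hsphere : Metric.sphere y r ⊆ Metric.closedBall y r := Metric.sphere_subset_closedBall
  obtain ⟨ε, hε, hεneg⟩ := exists_pos_forall_add_mul_neg (f := fun x ↦ u x - u y)
    (isCompact_sphere y r)
    ((hu.continuousOn.mono (hsphere.trans hrΩ)).sub continuousOn_const) hv.continuous.continuousOn
    (fun x hx ↦ sub_nonpos.2 (hmax x (hrΩ (hsphere hx)))) fun x hx hux ↦ by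
      refine (hrs (hsphere hx)).2.2 (lt_of_not_ge fun hxz ↦ ?_)
      exact (hball x (hrΩ (hsphere hx)) hxz (Metric.ne_of_mem_sphere hx hr.ne')).ne
        (sub_eq_zero.1 hux)
  have hux : ∀ x ∈ interior (Metric.closedBall y r), ContDiffAt ℝ 2 u x := fun x hx ↦
    hu.contDiffAt (hΩ.mem_nhds (hrΩ (interior_subset hx)))
  have hεv : ContDiff ℝ 2 (ε • v) := hv.const_smul ε
  obtain ⟨x, hx, hyx⟩ := exists_mem_frontier_ge_of_ellipticOp_pos (A := A) (b := b) (u := u + ε • v)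
    (isCompact_closedBall y r) (fun x hx ↦ (hpos x (hrΩ (interior_subset hx))).posSemidef)
    ((hu.continuousOn.mono hrΩ).add hεv.continuous.continuousOn)
    (fun x hx ↦ (hux x hx).add hεv.contDiffAt) (fun x hx ↦ by
      rw [ellipticOp_add (hux x hx) hεv.contDiffAt, ellipticOp_const_smul]
      exact add_pos_of_nonneg_of_pos (hL x (hrΩ (interior_subset hx)))
        (smul_pos hε (hrs (interior_subset hx)).2.1))
    (Metric.mem_closedBall_self hr.le)
  rw [frontier_closedBall y hr.ne'] at hx
  have := hεneg x hx
  simp only [Pi.add_apply, Pi.smul_apply, hvy, smul_eq_mul, mul_zero] at hyx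
  linarith

/-- E. Hopf's strong maximum principle. -/
theorem eventually_eq_of_isMaxOn_of_ellipticOp_nonneg (hΩ : IsOpen Ω) (hA : ContinuousOn A Ω)
    (hb : ContinuousOn b Ω) (hpos : ∀ x ∈ Ω, (A x).PosDef) (hu : ContDiffOn ℝ 2 u Ω)
    (hL : ∀ x ∈ Ω, 0 ≤ ellipticOp A b u x) (hx : x ∈ Ω) (hmax : IsMaxOn u Ω x) :
    ∀ᶠ y in nhds x, u y = u x := by
  obtain ⟨R, hR, hRΩ⟩ := Metric.nhds_basis_closedBall.mem_iff.1 (hΩ.mem_nhds hx)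
  by_contra hne
  obtain ⟨z, hz, hzu⟩ : ∃ z ∈ Metric.ball x (R / 2), u z ≠ u x := by
    by_contra! h
    exact hne (Filter.mem_of_superset (Metric.ball_mem_nhds x (half_pos hR)) h)
  let S := Metric.closedBall x R ∩ u ⁻¹' {u x}
  have hS : IsClosed S := (hu.continuousOn.mono hRΩ).preimage_isClosed_of_isClosed
    Metric.isClosed_closedBall isClosed_singleton
  have hxS : x ∈ S := ⟨Metric.mem_closedBall_self hR.le, rfl⟩
  obtain ⟨y, ⟨-, huy⟩, hyz⟩ := hS.exists_infDist_eq_dist ⟨x, hxS⟩ z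
  rw [Set.mem_preimage, Set.mem_singleton_iff] at huy
  have hclosest : ∀ w ∈ S, dist y z ≤ dist w z := fun w hw ↦ by
    rw [dist_comm y z, ← hyz, dist_comm w z]
    exact Metric.infDist_le_dist_of_mem hw
  have hyx : y ∈ Metric.ball x R := by
    have htri := dist_triangle_right y x z
    have hyxz := hclosest x hxS
    rw [Metric.mem_ball, dist_comm] at hz
    rw [Metric.mem_ball]
    linarith
  have hsub : Metric.ball x R ⊆ Ω := Metric.ball_subset_closedBall.trans hRΩ
  -- The ball about the midpoint of `y` and `z` through `y` meets `S` at `y` alone.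
  have hyne : y ≠ midpoint ℝ y z := fun h ↦ hzu (by rw [← huy, (left_eq_midpoint_iff ℝ).1 h])
  obtain ⟨w, hw, hlt⟩ := exists_lt_of_ellipticOp_nonneg_of_touching_ball Metric.isOpen_ball
    (hA.mono hsub) (hb.mono hsub) (fun w hw ↦ hpos w (hsub hw)) (hu.mono hsub)
    (fun w hw ↦ hL w (hsub hw)) hyx hyne fun w hw hwm hwy ↦ by
      refine (huy ▸ hmax (hsub hw)).lt_of_ne fun h ↦ ?_
      exact (dist_lt_of_dist_midpoint_le hwm hwy).not_ge
        (hclosest w ⟨Metric.ball_subset_closedBall hw, h.trans huy⟩)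
  exact hlt.not_ge (huy ▸ hmax (hsub hw))

end StrongMaximumPrinciple

section MatrixSmoothness

variable {𝕜 E ι : Type*} [NontriviallyNormedField 𝕜] [NormedAddCommGroup E] [NormedSpace 𝕜 E]
  [Fintype ι] [DecidableEq ι] {k : WithTop ℕ∞} {s : Set E} {A : E → Matrix ι ι 𝕜}

theorem contDiffOn_matrix_det (hA : ∀ i j, ContDiffOn 𝕜 k (fun y ↦ A y i j) s) :
    ContDiffOn 𝕜 k (fun y ↦ (A y).det) s := by
  simp only [Matrix.det_apply']
  exact ContDiffOn.sum fun σ _ ↦ contDiffOn_const.mul (contDiffOn_prod fun i _ ↦ hA _ _)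

theorem contDiffOn_matrix_adjugate (hA : ∀ i j, ContDiffOn 𝕜 k (fun y ↦ A y i j) s) (i j : ι) :
    ContDiffOn 𝕜 k (fun y ↦ (A y).adjugate i j) s := by
  simp only [Matrix.adjugate_apply]
  refine contDiffOn_matrix_det fun a b ↦ ?_
  simp only [Matrix.updateRow_apply]
  split_ifs
  · exact contDiffOn_const
  · exact hA a b

theorem contDiffOn_matrix_inv (hA : ∀ i j, ContDiffOn 𝕜 k (fun y ↦ A y i j) s)
    (hdet : ∀ y ∈ s, (A y).det ≠ 0) (i j : ι) : ContDiffOn 𝕜 k (fun y ↦ (A y)⁻¹ i j) s := by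
  simp only [Matrix.inv_def, Matrix.smul_apply, smul_eq_mul, Ring.inverse_eq_inv]
  exact ((contDiffOn_matrix_det hA).inv hdet).mul (contDiffOn_matrix_adjugate hA i j)

end MatrixSmoothness

section LocalCoordinates

variable {n : ℕ} {M : Type*} [TopologicalSpace M] [ChartedSpace (Model n) M]
  [IsManifold (𝓡 n) ∞ M] {g : Metric n M} {e : OpenPartialHomeomorph M (Model n)}

theorem contMDiffOn_symm_of_mem_atlas (he : e ∈ atlas (Model n) M) :
    ContMDiffOn (𝓡 n) (𝓡 n) ∞ e.symm e.target :=
  contMDiffOn_symm_of_mem_maximalAtlas (IsManifold.subset_maximalAtlas he)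

theorem contDiffOn_comp_symm {F : Type*} [NormedAddCommGroup F] [NormedSpace ℝ F] {φ : M → F}
    (hφ : ContMDiff (𝓡 n) 𝓘(ℝ, F) 2 φ) (he : e ∈ atlas (Model n) M) :
    ContDiffOn ℝ 2 (φ ∘ e.symm) e.target :=
  contMDiffOn_iff_contDiffOn.1 (hφ.comp_contMDiffOn
    ((contMDiffOn_symm_of_mem_atlas he).of_le (by norm_cast)))

theorem contDiffAt_comp_symm {F : Type*} [NormedAddCommGroup F] [NormedSpace ℝ F] {φ : M → F}
    (hφ : ContMDiff (𝓡 n) 𝓘(ℝ, F) 2 φ) (he : e ∈ atlas (Model n) M) {y : Model n}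
    (hy : y ∈ e.target) : ContDiffAt ℝ 2 (φ ∘ e.symm) y :=
  (contDiffOn_comp_symm hφ he).contDiffAt (e.open_target.mem_nhds hy)

theorem contMDiffOn_coordVector (he : e ∈ atlas (Model n) M) (i : Fin n) :
    ContMDiffOn (𝓡 n) (𝓡 n).tangent 1
      (fun y ↦ (⟨e.symm y, coordVector e i y⟩ : TangentBundle (𝓡 n) M)) e.target := by
  have htangent := (contMDiffOn_symm_of_mem_atlas he).contMDiffOn_tangentMapWithin (m := 1)
    (by norm_cast) e.open_target.uniqueMDiffOn
  have hsingle : ContMDiff (𝓡 n) (𝓡 n).tangent 1 (fun y : Model n ↦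
      (⟨y, EuclideanSpace.single i (1 : ℝ)⟩ : TangentBundle (𝓡 n) (Model n))) :=
    contMDiff_vectorSpace_iff_contDiff.2 contDiff_const
  refine (htangent.comp hsingle.contMDiffOn fun y hy ↦ hy).congr fun y hy ↦ ?_
  simp only [Function.comp, tangentMapWithin, coordVector,
    mfderivWithin_of_isOpen e.open_target hy]

theorem contDiffOn_metricMatrix (he : e ∈ atlas (Model n) M) (i j : Fin n) :
    ContDiffOn ℝ 1 (fun y ↦ metricMatrix g e y i j) e.target := by
  have h : ContMDiffOn (𝓡 n) ((𝓡 n).prod 𝓘(ℝ)) 1 (fun y ↦ Bundle.TotalSpace.mk' ℝ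
      (E := Bundle.Trivial M ℝ) (e.symm y) (metricMatrix g e y i j)) e.target :=
    ContMDiffOn.clm_bundle_apply₂ (F₁ := Model n) (F₂ := Model n)
      (E₁ := fun x : M ↦ TangentSpace (𝓡 n) x) (E₂ := fun x : M ↦ TangentSpace (𝓡 n) x)
      ((g.contMDiff.of_le (by norm_cast)).comp_contMDiffOn
        ((contMDiffOn_symm_of_mem_atlas he).of_le (by norm_cast)))
      (contMDiffOn_coordVector he i) (contMDiffOn_coordVector he j)
  exact contMDiffOn_iff_contDiffOn.1 fun y hy ↦ (Bundle.contMDiffWithinAt_totalSpace.1 (h y hy)).2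

theorem isSymm_metricMatrix (g : Metric n M) (e : OpenPartialHomeomorph M (Model n))
    (y : Model n) : (metricMatrix g e y).IsSymm :=
  Matrix.IsSymm.ext fun _ _ ↦ g.symm _ _ _

theorem posDef_metricMatrix (g : Metric n M) (he : e ∈ atlas (Model n) M) {y : Model n}
    (hy : y ∈ e.target) : (metricMatrix g e y).PosDef := by
  let D : Model n →L[ℝ] TangentSpace (𝓡 n) (e.symm y) := mfderiv (𝓡 n) (𝓡 n) e.symm y
  have hD : Function.Injective D :=
    (mdifferentiable_of_mem_atlas (I := 𝓡 n) he).symm.mfderiv_injective hy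
  let B : LinearMap.BilinForm ℝ (Model n) :=
    ((ContinuousLinearMap.coeLM ℝ).comp (g.inner (e.symm y)).toLinearMap).compl₁₂
      D.toLinearMap D.toLinearMap
  have hB : B.IsSymm := ⟨fun v w ↦ g.symm _ (D v) (D w)⟩
  have hmatrix : metricMatrix g e y = B.toMatrix (EuclideanSpace.basisFun (Fin n) ℝ).toBasis := by
    ext i j
    rw [LinearMap.BilinForm.toMatrix_apply, OrthonormalBasis.coe_toBasis,
      EuclideanSpace.basisFun_apply, EuclideanSpace.basisFun_apply]
    rfl
  rw [hmatrix, ← LinearMap.BilinForm.posDef_toQuadraticMap_iff_matrix _ _ hB]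
  exact fun v hv ↦ g.pos _ (D v) ((map_ne_zero_iff D hD).2 hv)

theorem density_pos (g : Metric n M) (he : e ∈ atlas (Model n) M) {y : Model n}
    (hy : y ∈ e.target) : 0 < density g e y :=
  Real.sqrt_pos.2 (posDef_metricMatrix g he hy).det_pos

theorem contDiffOn_density (he : e ∈ atlas (Model n) M) :
    ContDiffOn ℝ 1 (density g e) e.target :=
  (contDiffOn_matrix_det (contDiffOn_metricMatrix he)).sqrt fun _ hy ↦
    (posDef_metricMatrix g he hy).det_pos.ne'

theorem contDiffOn_metricMatrix_inv (he : e ∈ atlas (Model n) M) (i j : Fin n) :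
    ContDiffOn ℝ 1 (fun y ↦ (metricMatrix g e y)⁻¹ i j) e.target :=
  contDiffOn_matrix_inv (contDiffOn_metricMatrix he)
    (fun _ hy ↦ (posDef_metricMatrix g he hy).det_pos.ne') i j

/-- The first-order coefficients `b_i = |g|^(-1/2) ∑ j, ∂_j (g^ij |g|^(1/2))` of the
Laplace-Beltrami operator in the chart `e`, when it is written in non-divergence form. -/
noncomputable def drift (g : Metric n M) (e : OpenPartialHomeomorph M (Model n)) (y : Model n) :
    Model n :=
  WithLp.toLp 2 fun i ↦ (density g e y)⁻¹ * ∑ j,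
    fderiv ℝ (fun z ↦ (metricMatrix g e z)⁻¹ i j * density g e z) y (EuclideanSpace.single j 1)

/-- The Laplace-Beltrami operator in the coordinates of the chart `e`, in non-divergence form,
for functions of the coordinates with values in any real normed space. -/
noncomputable def localLaplacian {F : Type*} [NormedAddCommGroup F] [NormedSpace ℝ F]
    (g : Metric n M) (e : OpenPartialHomeomorph M (Model n)) (u : Model n → F) : Model n → F :=
  ellipticOp (fun y ↦ (metricMatrix g e y)⁻¹) (drift g e) u

theorem contDiffOn_metricMatrix_inv_mul_density (he : e ∈ atlas (Model n) M) (i j : Fin n) :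
    ContDiffOn ℝ 1 (fun y ↦ (metricMatrix g e y)⁻¹ i j * density g e y) e.target :=
  (contDiffOn_metricMatrix_inv he i j).mul (contDiffOn_density he)

theorem continuousOn_metricMatrix_inv (he : e ∈ atlas (Model n) M) :
    ContinuousOn (fun y ↦ (metricMatrix g e y)⁻¹) e.target :=
  continuousOn_pi.2 fun i ↦ continuousOn_pi.2 fun j ↦
    (contDiffOn_metricMatrix_inv he i j).continuousOn

theorem continuousOn_drift (he : e ∈ atlas (Model n) M) :
    ContinuousOn (drift g e) e.target := by
  refine (PiLp.continuous_toLp 2 _).comp_continuousOn (continuousOn_pi.2 fun i ↦ ?_)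
  refine ((contDiffOn_density he).continuousOn.inv₀ fun y hy ↦ (density_pos g he hy).ne').mul
    (continuousOn_finsetSum _ fun j _ ↦ ?_)
  exact ((contDiffOn_metricMatrix_inv_mul_density he i j).continuousOn_fderiv_of_isOpen
    e.open_target le_rfl).clm_apply continuousOn_const

theorem map_drift {F : Type*} [NormedAddCommGroup F] [NormedSpace ℝ F]
    (L : Model n →L[ℝ] F) (y : Model n) :
    L (drift g e y) = (density g e y)⁻¹ • ∑ i, ∑ j,
      fderiv ℝ (fun z ↦ (metricMatrix g e z)⁻¹ i j * density g e z) y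
        (EuclideanSpace.single j 1) • L (EuclideanSpace.single i 1) := by
  have hsum := (EuclideanSpace.basisFun (Fin n) ℝ).sum_repr (drift g e y)
  rw [← hsum, map_sum]
  simp [drift, Finset.smul_sum, Finset.sum_smul, Finset.mul_sum, smul_smul]

theorem tau_eq_localLaplacian (he : e ∈ atlas (Model n) M) {φ : M → ℂ}
    (hφ : ContMDiff (𝓡 n) 𝓘(ℝ, ℂ) 2 φ) {p : M} (hp : p ∈ e.source) :
    tau g e φ p = localLaplacian g e (φ ∘ e.symm) (e p) := by
  have hy := e.map_source hp
  have hf := contDiffAt_comp_symm hφ he hy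
  have hρ := (density_pos g he hy).ne'
  have hdiff : ∀ i j, DifferentiableAt ℝ
      (fun y ↦ (metricMatrix g e y)⁻¹ i j * density g e y) (e p) := fun i j ↦
    ((contDiffOn_metricMatrix_inv_mul_density he i j).contDiffAt
      (e.open_target.mem_nhds hy)).differentiableAt one_ne_zero
  rw [localLaplacian, ellipticOp, map_drift, Finset.smul_sum, ← Finset.sum_add_distrib]
  refine Finset.sum_congr rfl fun i _ ↦ ?_
  rw [Finset.smul_sum, ← Finset.sum_add_distrib]
  refine Finset.sum_congr rfl fun j _ ↦ ?_
  simp only [partialDeriv, ← Complex.real_smul]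
  rw [fderiv_smul_fderiv_apply (hdiff i j) hf, one_div, smul_add, smul_smul,
    mul_comm _ (density g e (e p)), inv_mul_cancel_left₀ hρ]

end LocalCoordinates

section StrongMaximumPrincipleOnManifold

variable {n : ℕ} {M : Type*} [TopologicalSpace M] [ChartedSpace (Model n) M]
  [IsManifold (𝓡 n) ∞ M] {g : Metric n M} {u : M → ℝ}

theorem eventually_eq_of_isMaxOn_of_localLaplacian_nonneg
    (hu : ContMDiff (𝓡 n) 𝓘(ℝ, ℝ) 2 u)
    (hL : ∀ e ∈ atlas (Model n) M, ∀ y ∈ e.target, 0 ≤ localLaplacian g e (u ∘ e.symm) y) {p : M}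
    (hmax : IsMaxOn u Set.univ p) : ∀ᶠ q in nhds p, u q = u p := by
  let e := chartAt (Model n) p
  have he : e ∈ atlas (Model n) M := chart_mem_atlas _ p
  have hp : p ∈ e.source := mem_chart_source _ p
  have hlocal := eventually_eq_of_isMaxOn_of_ellipticOp_nonneg e.open_target
    (continuousOn_metricMatrix_inv he) (continuousOn_drift he)
    (fun y hy ↦ (posDef_metricMatrix g he hy).inv) (contDiffOn_comp_symm hu he) (hL e he)
    (e.map_source hp) (isMaxOn_iff.2 fun y _ ↦ by
      simpa only [Function.comp_apply, e.left_inv hp] using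
        isMaxOn_iff.1 hmax (e.symm y) (Set.mem_univ _))
  filter_upwards [(e.continuousAt hp).eventually hlocal, e.open_source.mem_nhds hp] with q hq hqs
  simpa only [Function.comp_apply, e.left_inv hqs, e.left_inv hp] using hq

theorem eq_of_localLaplacian_nonneg [CompactSpace M] [PreconnectedSpace M]
    (hu : ContMDiff (𝓡 n) 𝓘(ℝ, ℝ) 2 u)
    (hL : ∀ e ∈ atlas (Model n) M, ∀ y ∈ e.target, 0 ≤ localLaplacian g e (u ∘ e.symm) y)
    (p q : M) : u p = u q := by
  obtain ⟨p₀, -, hp₀⟩ := isCompact_univ.exists_isMaxOn ⟨p, Set.mem_univ p⟩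
    hu.continuous.continuousOn
  have hclopen : IsClopen {q | u q = u p₀} := by
    refine ⟨isClosed_eq hu.continuous continuous_const, isOpen_iff_mem_nhds.2 fun q hq ↦ ?_⟩
    have hqmax : IsMaxOn u Set.univ q :=
      isMaxOn_iff.2 fun r hr ↦ (isMaxOn_iff.1 hp₀ r hr).trans_eq hq.symm
    filter_upwards [eventually_eq_of_isMaxOn_of_localLaplacian_nonneg hu hL hqmax] with r hr
      using hr.trans hq
  have huniv := Set.eq_univ_iff_forall.1 (hclopen.eq_univ ⟨p₀, rfl⟩)
  exact (huniv p).trans (huniv q).symm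

end StrongMaximumPrincipleOnManifold

section Span

theorem contMDiff_of_mem_span {n : ℕ} {M : Type*} [TopologicalSpace M]
    [ChartedSpace (Model n) M] {F : Set (M → ℂ)} {φ : M → ℂ}
    (hF : ∀ φ ∈ F, ContMDiff (𝓡 n) 𝓘(ℝ, ℂ) 2 φ)
    (hφ : φ ∈ Submodule.span ℂ F) : ContMDiff (𝓡 n) 𝓘(ℝ, ℂ) 2 φ := by
  induction hφ using Submodule.span_induction with
  | mem φ hφ => exact hF φ hφ
  | zero => exact contMDiff_const
  | add φ ψ _ _ hφ hψ => exact hφ.add hψ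
  | smul c φ _ hφ => exact (contDiff_const_smul c).contMDiff.comp hφ

variable {n : ℕ} {M : Type*} [TopologicalSpace M] [ChartedSpace (Model n) M]
  [IsManifold (𝓡 n) ∞ M] {g : Metric n M} {e : OpenPartialHomeomorph M (Model n)}
  {F : Set (M → ℂ)} {φ ψ : M → ℂ} {p : M}

theorem tau_add (he : e ∈ atlas (Model n) M) (hφ : ContMDiff (𝓡 n) 𝓘(ℝ, ℂ) 2 φ)
    (hψ : ContMDiff (𝓡 n) 𝓘(ℝ, ℂ) 2 ψ) (hp : p ∈ e.source) :
    tau g e (φ + ψ) p = tau g e φ p + tau g e ψ p := by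
  rw [tau_eq_localLaplacian he (hφ.add hψ) hp, tau_eq_localLaplacian he hφ hp,
    tau_eq_localLaplacian he hψ hp]
  exact ellipticOp_add (contDiffAt_comp_symm hφ he (e.map_source hp))
    (contDiffAt_comp_symm hψ he (e.map_source hp))

theorem partialDeriv_const_mul (i : Fin n) (c : ℂ) (f : Model n → ℂ) (y : Model n) :
    partialDeriv i (fun y ↦ c * f y) y = c * partialDeriv i f y := by
  simp only [partialDeriv, ← smul_eq_mul, ← Pi.smul_def, fderiv_const_smul_field, Pi.smul_apply,
    smul_apply]

theorem tau_const_smul (c : ℂ) : tau g e (c • φ) p = c * tau g e φ p := by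
  have hcomp : (c • φ) ∘ e.symm = fun y ↦ c * (φ ∘ e.symm) y := rfl
  simp only [tau, hcomp, partialDeriv_const_mul, mul_left_comm _ c, Finset.mul_sum]

theorem tau_eq_of_mem_span {lam : ℂ} (hF : ∀ φ ∈ F, ContMDiff (𝓡 n) 𝓘(ℝ, ℂ) 2 φ)
    (he : e ∈ atlas (Model n) M) (hp : p ∈ e.source) (h : ∀ φ ∈ F, tau g e φ p = lam * φ p)
    (hφ : φ ∈ Submodule.span ℂ F) : tau g e φ p = lam * φ p := by
  induction hφ using Submodule.span_induction with
  | mem φ hφ => exact h φ hφ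
  | zero => simp [tau, partialDeriv]
  | add φ ψ hφ hψ ihφ ihψ =>
    rw [tau_add he (contMDiff_of_mem_span hF hφ) (contMDiff_of_mem_span hF hψ) hp, ihφ, ihψ,
      Pi.add_apply, mul_add]
  | smul c φ hφ ih =>
    rw [tau_const_smul, ih, Pi.smul_apply, smul_eq_mul, mul_left_comm]

theorem kappa_comm (g : Metric n M) (e : OpenPartialHomeomorph M (Model n)) (φ ψ : M → ℂ) (p : M) :
    kappa g e φ ψ p = kappa g e ψ φ p := by
  rw [kappa, kappa, Finset.sum_comm]
  refine Finset.sum_congr rfl fun i _ ↦ Finset.sum_congr rfl fun j _ ↦ ?_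
  rw [(isSymm_metricMatrix g e (e p)).inv.apply, mul_right_comm]

theorem kappa_add_left (he : e ∈ atlas (Model n) M) (hφ : ContMDiff (𝓡 n) 𝓘(ℝ, ℂ) 2 φ)
    (hψ : ContMDiff (𝓡 n) 𝓘(ℝ, ℂ) 2 ψ) (χ : M → ℂ) (hp : p ∈ e.source) :
    kappa g e (φ + ψ) χ p = kappa g e φ χ p + kappa g e ψ χ p := by
  have hdφ := (contDiffAt_comp_symm hφ he (e.map_source hp)).differentiableAt two_ne_zero
  have hdψ := (contDiffAt_comp_symm hψ he (e.map_source hp)).differentiableAt two_ne_zero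
  have hadd : ∀ i, partialDeriv i ((φ + ψ) ∘ e.symm) (e p) =
      partialDeriv i (φ ∘ e.symm) (e p) + partialDeriv i (ψ ∘ e.symm) (e p) := fun i ↦
    DFunLike.congr_fun (fderiv_add hdφ hdψ) _
  simp only [kappa, hadd, mul_add, add_mul, Finset.sum_add_distrib]

theorem kappa_const_smul_left (c : ℂ) (φ ψ : M → ℂ) :
    kappa g e (c • φ) ψ p = c * kappa g e φ ψ p := by
  have hcomp : (c • φ) ∘ e.symm = fun y ↦ c * (φ ∘ e.symm) y := rfl
  simp only [kappa, hcomp, partialDeriv_const_mul, mul_left_comm _ c, mul_assoc, Finset.mul_sum]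

theorem kappa_eq_of_mem_span {mu : ℂ} (hF : ∀ φ ∈ F, ContMDiff (𝓡 n) 𝓘(ℝ, ℂ) 2 φ)
    (he : e ∈ atlas (Model n) M) (hp : p ∈ e.source)
    (h : ∀ φ ∈ F, kappa g e φ ψ p = mu * (φ p * ψ p)) (hφ : φ ∈ Submodule.span ℂ F) :
    kappa g e φ ψ p = mu * (φ p * ψ p) := by
  induction hφ using Submodule.span_induction with
  | mem φ hφ => exact h φ hφ
  | zero => simp [kappa, partialDeriv]
  | add φ χ hφ hχ ihφ ihχ =>
    rw [kappa_add_left he (contMDiff_of_mem_span hF hφ) (contMDiff_of_mem_span hF hχ) _ hp, ihφ,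
      ihχ, Pi.add_apply, add_mul, mul_add]
  | smul c φ _ ih =>
    rw [kappa_const_smul_left, ih, Pi.smul_apply, smul_eq_mul, mul_assoc c, mul_left_comm]

theorem IsEigenfamily.span {lam mu : ℂ} (hF : IsEigenfamily g lam mu F) :
    IsEigenfamily g lam mu (Submodule.span ℂ F : Set (M → ℂ)) where
  contMDiff _ hφ := contMDiff_of_mem_span hF.contMDiff hφ
  tau_eq _ hφ e he _ hp :=
    tau_eq_of_mem_span hF.contMDiff he hp (fun φ hφ ↦ hF.tau_eq φ hφ e he _ hp) hφ
  kappa_eq φ hφ ψ hψ e he p hp := by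
    refine kappa_eq_of_mem_span hF.contMDiff he hp (fun φ hφ ↦ ?_) hφ
    rw [kappa_comm, mul_comm (φ p)]
    refine kappa_eq_of_mem_span hF.contMDiff he hp (fun ψ hψ ↦ ?_) hψ
    exact hF.kappa_eq ψ hψ φ hφ e he p hp

end Span

section Subharmonic

variable {n : ℕ} {M : Type*} [TopologicalSpace M] [ChartedSpace (Model n) M]
  [IsManifold (𝓡 n) ∞ M] {g : Metric n M} {lam mu : ℂ} {χ : M → ℂ}

theorem le_localLaplacian_norm_sq {e : OpenPartialHomeomorph M (Model n)}
    (he : e ∈ atlas (Model n) M) (hχ : ContMDiff (𝓡 n) 𝓘(ℝ, ℂ) 2 χ) {p : M} (hp : p ∈ e.source) :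
    2 * (inner ℝ (χ p) (tau g e χ p) + ‖kappa g e χ χ p‖) ≤
      localLaplacian g e (fun y ↦ ‖χ (e.symm y)‖ ^ 2) (e p) := by
  have hy := e.map_source hp
  have hkappa := norm_sum_sum_mul_le_sum_sum_inner (posDef_metricMatrix g he hy).inv.posSemidef
    fun i ↦ partialDeriv i (χ ∘ e.symm) (e p)
  have hsq := ellipticOp_norm_sq (A := fun y ↦ (metricMatrix g e y)⁻¹) (b := drift g e)
    (contDiffAt_comp_symm hχ he hy)
  rw [Function.comp_apply, e.left_inv hp] at hsq
  rw [tau_eq_localLaplacian he hχ hp]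
  refine le_of_le_of_eq ?_ hsq.symm
  exact mul_le_mul_of_nonneg_left (add_le_add_right hkappa _) zero_le_two

theorem IsEigenfamily.norm_eq [CompactSpace M] [PreconnectedSpace M] {F : Set (M → ℂ)}
    (hF : IsEigenfamily g lam mu F) (h : 0 ≤ lam.re + ‖mu‖) (hχ : χ ∈ F) (p q : M) :
    ‖χ p‖ = ‖χ q‖ := by
  have hχ2 := hF.contMDiff χ hχ
  refine (sq_eq_sq₀ (norm_nonneg _) (norm_nonneg _)).1 <|
    eq_of_localLaplacian_nonneg (g := g) (u := fun p ↦ ‖χ p‖ ^ 2)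
      ((contDiff_norm_sq ℝ).contMDiff.comp hχ2) (fun e he y hy ↦ ?_) p q
  have hp := e.map_target hy
  have hle := le_localLaplacian_norm_sq (g := g) he hχ2 hp
  rw [e.right_inv hy, hF.tau_eq χ hχ e he _ hp, hF.kappa_eq χ hχ χ hχ e he _ hp] at hle
  refine le_trans ?_ hle
  have hinner : ∀ w : ℂ, inner ℝ w (lam * w) = lam.re * ‖w‖ ^ 2 := fun w ↦ by
    rw [Complex.inner, mul_assoc, Complex.mul_conj, Complex.re_mul_ofReal,
      Complex.normSq_eq_norm_sq]
  rw [hinner, norm_mul mu, norm_mul, ← sq, ← add_mul]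
  positivity

end Subharmonic

end Eigenfamily

theorem proposition1p2_general {n : ℕ} {M : Type*} [TopologicalSpace M] [CompactSpace M]
    [ConnectedSpace M] [ChartedSpace (Eigenfamily.Model n) M] [IsManifold (𝓡 n) ∞ M]
    (g : Eigenfamily.Metric n M) {lam mu : ℂ} (h : 0 ≤ lam.re + ‖mu‖) (F : Set (M → ℂ))
    (hF : Eigenfamily.IsEigenfamily g lam mu F) :
    Module.rank ℂ (Submodule.span ℂ F) ≤ 1 := by
  obtain ⟨p⟩ : Nonempty M := inferInstance
  let evalAt : Submodule.span ℂ F →ₗ[ℂ] ℂ :=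
    (LinearMap.proj (φ := fun _ : M ↦ ℂ) p).domRestrict (Submodule.span ℂ F)
  have hevalAt : Function.Injective evalAt := by
    refine (injective_iff_map_eq_zero evalAt).2 fun χ (hχ : χ.1 p = 0) ↦ Subtype.ext ?_
    have hnorm : ∀ q, ‖χ.1 q‖ = 0 := fun q ↦
      (hF.span.norm_eq h χ.2 q p).trans (norm_eq_zero.2 hχ)
    exact funext fun q ↦ norm_eq_zero.1 (hnorm q)
  simpa using LinearMap.lift_rank_le_of_injective evalAt hevalAt

theorem proposition1p2 {n : ℕ} {M : Type*} [TopologicalSpace M] [T2Space M] [CompactSpace M]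
    [ConnectedSpace M] [ChartedSpace (Eigenfamily.Model n) M] [IsManifold (𝓡 n) ∞ M]
    (g : Eigenfamily.Metric n M) (lam : ℂ) (F : Set (M → ℂ))
    (hF : Eigenfamily.IsEigenfamily g lam lam F) :
    Module.rank ℂ (Submodule.span ℂ F) ≤ 1 :=
  proposition1p2_general g (neg_le_iff_add_nonneg.1 (abs_le.1 (Complex.abs_re_le_norm lam)).1) F hF
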